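/- Let $G$ be a real Lie group and let $V$ be a finite-dimensional real vector space. A representation $(G,V)$ is a smooth group homomorphism $\Phi:G\to \mathrm{Aut}(V)$. Two representations $\Phi:G\to\mathrm{Aut}(V)$ and $\Phi':G\to\mathrm{Aut}(V')$ are equivalent if there is an intertwining isomorphism between them, that is, a linear isomorphism $A:V\to V'$ with $A(\Phi(a)p)=\Phi'(a)(Ap)$ for all $a\in G$, $p\in V$. The tangent bundle $TG$ is a Lie group, whose product is the tangent map of the product of $G$ (with $T(G\times G)\cong TG\times TG$). The tangent bundle $TV$ is a vector space of dimension $2\dim V$ with the operations $X\oplus Y=(T\tau_y)X+(T\tau_x)Y$ for $X\in T_xV$, $Y\in T_yV$, and $\lambda\bullet X=(T\sigma_\lambda)X$, where $\tau_x$ is the translation by $x$ and $\sigma_\lambda$ is the multiplication by $\lambda$. Let $\alpha=(\alpha_1,\dots,\alpha_n)$ be a basis of $V$. Let $\psi:TV\to V\times\mathbb R^n$ be the linear isomorphism $\psi\big(\sum_i v_i(\partial/\partial x_i)_p\big)=(p,(v_1,\dots,v_n))$, where $x_1,\dots,x_n$ are the linear coordinates of $\alpha$. Let $Z:\mathrm{Aut}(V)\to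 GL(n,\mathbb R)$ and $\breve Z:\mathrm{Aut}(TV)\to GL(2n,\mathbb R)$ be the isomorphisms that send an automorphism to its matrix in the basis $\alpha$ of $V$ and in the basis $\psi^{-1}(\alpha_1,0),\dots,\psi^{-1}(\alpha_n,0),\psi^{-1}(0,e_1),\dots,\psi^{-1}(0,e_n)$ of $TV$, respectively. Let $$J_n:T(GL(n,\mathbb R))\to GL(2n,\mathbb R),\qquad J_n(Y)=\begin{pmatrix}a&0\\ Ba&a\end{pmatrix}\quad\text{for } Y\in T_a GL(n,\mathbb R),\ B=(TR_{a^{-1}})Y,$$ where $R_{a^{-1}}$ is the right translation by $a^{-1}$. The prolongation $(TG,TV)$ of $\Phi$ is the representation $$\widetilde\Phi=\breve Z^{-1}\circ J_n\circ TZ\circ T\Phi:TG\to\mathrm{Aut}(TV).$$ **Proposition.** Let $\Phi:G\to\mathrm{Aut}(V)$ and $\Phi':G\to\mathrm{Aut}(V')$ be representations of a Lie group $G$ on finite-dimensional real vector spaces, and let $\widetilde\Phi$ and $\widetilde\Phi'$ be their prolongations, formed with any bases of $V$ and $V'$. If $\Phi$ and $\Phi'$ are equivalent, then $\widetilde\Phi$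 and $\widetilde\Phi'$ are equivalent. More precisely, if $A:V\to V'$ is an intertwining isomorphism from $\Phi$ to $\Phi'$, then the tangent map $TA:TV\to TV'$ is a linear isomorphism and $$TA\big(\widetilde\Phi(X)(Y)\big)=\widetilde\Phi'(X)\big(TA(Y)\big)\qquad\text{for all } X\in TG,\ Y\in TV.$$ -/

import Mathlib

open Bundle
open scoped Manifold ContDiff

noncomputable section

namespace Prolongation

section TangentGroup

variable {E : Type*} [NormedAddCommGroup E] [NormedSpace ℝ E]
  {H : Type*} [TopologicalSpace H] {I : ModelWithCorners ℝ E H}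
  {G : Type*} [TopologicalSpace G] [ChartedSpace H G] [Group G]

/-- The product of `TG`: the tangent map of the product of `G`, read on `TG × TG ≃ T(G × G)`. -/
instance instMulTangent : Mul (TangentBundle I G) where
  mul X Y := tangentMap (I.prod I) I (fun p : G × G => p.1 * p.2)
    ((equivTangentBundleProd I G I G).symm (X, Y))

/-- The unit of `TG`: the zero vector at the unit of `G`. -/
instance instOneTangent : One (TangentBundle I G) where
  one := ⟨1, 0⟩

/-- The inverse of `TG`: the tangent map of the inverse of `G`. -/
instance instInvTangent : Inv (TangentBundle I G) where
  inv X := tangentMap I I (fun g : G => g⁻¹) X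

variable {E₁ : Type*} [NormedAddCommGroup E₁] [NormedSpace ℝ E₁]
  {H₁ : Type*} [TopologicalSpace H₁] {J : ModelWithCorners ℝ E₁ H₁}
  {M : Type*} [TopologicalSpace M] [ChartedSpace H₁ M]

lemma tangentMap_const_one (Z : TangentBundle J M) :
    tangentMap J I (fun _ : M => (1 : G)) Z = 1 := by
  simp only [tangentMap, mfderiv_const]
  rfl

lemma tangentMap_mul [LieGroup I ∞ G] {u v : M → G} (hu : MDifferentiable J I u)
    (hv : MDifferentiable J I v) (Z : TangentBundle J M) :
    tangentMap J I (fun m => u m * v m) Z = tangentMap J I u Z * tangentMap J I v Z := by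
  have hm : MDifferentiable (I.prod I) I (fun p : G × G => p.1 * p.2) :=
    (contMDiff_mul I ∞).mdifferentiable (by simp)
  have h := tangentMap_comp_at (I := J) (I' := I.prod I) (I'' := I)
    (g := fun p : G × G => p.1 * p.2) (f := fun m => (u m, v m)) Z (hm _)
    ((hu _).prodMk (hv _))
  refine h.trans ?_
  change _ = tangentMap (I.prod I) I (fun p : G × G => p.1 * p.2) _
  congr 1
  simp only [tangentMap]
  rw [mfderiv_prodMk (hu _) (hv _)]
  rfl

instance instGroupTangent [LieGroup I ∞ G] : Group (TangentBundle I G) where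
  mul_assoc X Y W := by
    let Z : TangentBundle (I.prod (I.prod I)) (G × G × G) :=
      (equivTangentBundleProd I G (I.prod I) (G × G)).symm
        (X, (equivTangentBundleProd I G I G).symm (Y, W))
    have m1 : MDifferentiable (I.prod (I.prod I)) I (fun p : G × G × G => p.1) :=
      mdifferentiable_fst
    have m2 : MDifferentiable (I.prod (I.prod I)) I (fun p : G × G × G => p.2.1) :=
      mdifferentiable_fst.comp mdifferentiable_snd
    have m3 : MDifferentiable (I.prod (I.prod I)) I (fun p : G × G × G => p.2.2) :=
      mdifferentiable_snd.comp mdifferentiable_snd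
    have mm : MDifferentiable (I.prod I) I (fun p : G × G => p.1 * p.2) :=
      (contMDiff_mul I ∞).mdifferentiable (by simp)
    have h1 : tangentMap (I.prod (I.prod I)) I (fun p : G × G × G => p.1) Z = X := by
      refine (tangentMap_prodFst (I := I) (I' := I.prod I)).trans ?_
      rfl
    have h23 : tangentMap (I.prod (I.prod I)) (I.prod I) (Prod.snd : G × G × G → G × G) Z
        = (equivTangentBundleProd I G I G).symm (Y, W) := by
      refine (tangentMap_prodSnd (I := I) (I' := I.prod I)).trans ?_
      rfl
    have h2 : tangentMap (I.prod (I.prod I)) I (fun p : G × G × G => p.2.1) Z = Y := by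
      refine (tangentMap_comp_at (I := I.prod (I.prod I)) (I' := I.prod I) (I'' := I)
        (g := (Prod.fst : G × G → G)) (f := Prod.snd) Z mdifferentiableAt_fst
        mdifferentiableAt_snd).trans ?_
      rw [h23]
      exact tangentMap_prodFst
    have h3 : tangentMap (I.prod (I.prod I)) I (fun p : G × G × G => p.2.2) Z = W := by
      refine (tangentMap_comp_at (I := I.prod (I.prod I)) (I' := I.prod I) (I'' := I)
        (g := (Prod.snd : G × G → G)) (f := Prod.snd) Z mdifferentiableAt_snd
        mdifferentiableAt_snd).trans ?_
      rw [h23]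
      exact tangentMap_prodSnd
    have m12 : MDifferentiable (I.prod (I.prod I)) I (fun p : G × G × G => p.1 * p.2.1) :=
      mm.comp (m1.prodMk m2)
    have m23 : MDifferentiable (I.prod (I.prod I)) I (fun p : G × G × G => p.2.1 * p.2.2) :=
      mm.comp (m2.prodMk m3)
    rw [← h1, ← h2, ← h3, ← tangentMap_mul m1 m2, ← tangentMap_mul m12 m3,
      ← tangentMap_mul m2 m3, ← tangentMap_mul m1 m23]
    simp only [mul_assoc]
  one_mul X := by
    have h := tangentMap_mul (I := I) (J := I) (u := fun _ : G => (1 : G)) (v := id)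
      mdifferentiable_const mdifferentiable_id X
    rw [tangentMap_const_one, tangentMap_id] at h
    simp only [one_mul] at h
    exact h.symm.trans (congrFun tangentMap_id X)
  mul_one X := by
    have h := tangentMap_mul (I := I) (J := I) (v := fun _ : G => (1 : G)) (u := id)
      mdifferentiable_id mdifferentiable_const X
    rw [tangentMap_const_one, tangentMap_id] at h
    simp only [mul_one] at h
    exact h.symm.trans (congrFun tangentMap_id X)
  inv_mul_cancel X := by
    have h := tangentMap_mul (I := I) (J := I) (u := fun g : G => g⁻¹) (v := id)
      ((contMDiff_inv I ∞).mdifferentiable (by simp)) mdifferentiable_id X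
    rw [tangentMap_id] at h
    simp only [id, inv_mul_cancel] at h
    exact h.symm.trans (tangentMap_const_one X)

instance instLieGroupTangent [LieGroup I ∞ G] :
    LieGroup I.tangent ∞ (TangentBundle I G) where
  contMDiff_mul := by
    have h : ContMDiff (I.prod I).tangent I.tangent ∞
        (tangentMap (I.prod I) I (fun p : G × G => p.1 * p.2)) :=
      (contMDiff_mul I ∞).contMDiff_tangentMap (by simp)
    exact h.comp contMDiff_equivTangentBundleProd_symm
  contMDiff_inv := (contMDiff_inv I ∞).contMDiff_tangentMap (by simp)

/-- The tangent map of a homomorphism of Lie groups is a homomorphism of Lie groups. -/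
def tangentHom [LieGroup I ∞ G] {G' : Type*} [TopologicalSpace G'] [ChartedSpace H₁ G'] [Group G']
    [LieGroup J ∞ G'] (γ : ContMDiffMonoidMorphism I J ∞ G G') :
    ContMDiffMonoidMorphism I.tangent J.tangent ∞ (TangentBundle I G) (TangentBundle J G') where
  toFun := tangentMap I J γ
  map_one' := by
    refine TotalSpace.ext (map_one γ) ?_
    simp only [tangentMap]
    exact heq_of_eq_of_heq (map_zero (mfderiv I J γ (1 : G))) (by rw [map_one γ]; rfl)
  map_mul' X Y := by
    have hγ : MDifferentiable I J γ := γ.contMDiff_toFun.mdifferentiable (by simp)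
    let Z := (equivTangentBundleProd I G I G).symm (X, Y)
    have hm : MDifferentiable (I.prod I) I (fun p : G × G => p.1 * p.2) :=
      (contMDiff_mul I ∞).mdifferentiable (by simp)
    have h := tangentMap_comp_at (I := I.prod I) (I' := I) (I'' := J) (g := γ)
      (f := fun p : G × G => p.1 * p.2) Z (hγ _) (hm _)
    refine h.symm.trans ?_
    have e : (γ ∘ fun p : G × G => p.1 * p.2) = fun p => (γ ∘ Prod.fst) p * (γ ∘ Prod.snd) p := by
      funext p; simp
    rw [e, tangentMap_mul (hγ.comp mdifferentiable_fst) (hγ.comp mdifferentiable_snd),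
      tangentMap_comp_at (I' := I) _ (hγ _) mdifferentiableAt_fst,
      tangentMap_comp_at (I' := I) _ (hγ _) mdifferentiableAt_snd, tangentMap_prodFst,
      tangentMap_prodSnd]
    rfl
  contMDiff_toFun := γ.contMDiff_toFun.contMDiff_tangentMap (by simp)

end TangentGroup
section TangentVector

variable {V : Type*} [NormedAddCommGroup V] [NormedSpace ℝ V]

/-- The sum `X ⊕ Y = (Tτ_y) X + (Tτ_x) Y` for `X ∈ T_x V`, `Y ∈ T_y V`, where `τ_z` is the
translation by `z`; the right-hand side is a sum in `T_{x + y} V`. -/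
instance instAddTangent : Add (TangentBundle 𝓘(ℝ, V) V) where
  add X Y := ⟨X.proj + Y.proj,
    (mfderiv 𝓘(ℝ, V) 𝓘(ℝ, V) (fun z : V => z + Y.proj) X.proj X.snd :
        TangentSpace 𝓘(ℝ, V) (X.proj + Y.proj))
      + (mfderiv 𝓘(ℝ, V) 𝓘(ℝ, V) (fun z : V => X.proj + z) Y.proj Y.snd :
        TangentSpace 𝓘(ℝ, V) (X.proj + Y.proj))⟩

/-- The scalar multiple `c • X = (Tσ_c) X`, where `σ_c` is the multiplication by `c`. -/
instance instSMulTangent : SMul ℝ (TangentBundle 𝓘(ℝ, V) V) where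
  smul c X := tangentMap 𝓘(ℝ, V) 𝓘(ℝ, V) (fun z : V => c • z) X

instance instZeroTangent : Zero (TangentBundle 𝓘(ℝ, V) V) where
  zero := ⟨0, 0⟩

instance instNegTangent : Neg (TangentBundle 𝓘(ℝ, V) V) where
  neg X := (-1 : ℝ) • X

/-- The identification of `TV` with `V × V`: base point and vector. -/
def toProd : TangentBundle 𝓘(ℝ, V) V ≃ V × V where
  toFun X := (X.proj, X.snd)
  invFun p := ⟨p.1, p.2⟩

lemma toProd_add (X Y : TangentBundle 𝓘(ℝ, V) V) : toProd (X + Y) = toProd X + toProd Y := by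
  refine Prod.ext rfl ?_
  change (mfderiv 𝓘(ℝ, V) 𝓘(ℝ, V) (fun z : V => z + Y.proj) X.proj X.snd : V)
      + (mfderiv 𝓘(ℝ, V) 𝓘(ℝ, V) (fun z : V => X.proj + z) Y.proj Y.snd : V) = (toProd X).2 + (toProd Y).2
  rw [mfderiv_eq_fderiv, mfderiv_eq_fderiv, fderiv_add_const, fderiv_const_add]
  simp only [fderiv_fun_id]
  rfl

lemma toProd_smul (c : ℝ) (X : TangentBundle 𝓘(ℝ, V) V) : toProd (c • X) = c • toProd X := by
  refine Prod.ext rfl ?_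
  change (mfderiv 𝓘(ℝ, V) 𝓘(ℝ, V) (fun z : V => c • z) X.proj X.snd : V) = c • (toProd X).2
  rw [mfderiv_eq_fderiv, fderiv_fun_const_smul differentiableAt_fun_id]
  simp only [fderiv_fun_id]
  rfl

lemma toProd_zero : toProd (0 : TangentBundle 𝓘(ℝ, V) V) = 0 := rfl

lemma toProd_neg (X : TangentBundle 𝓘(ℝ, V) V) : toProd (-X) = -toProd X := by
  change toProd ((-1 : ℝ) • X) = _
  rw [toProd_smul, neg_one_smul]

instance instAddCommGroupTangent : AddCommGroup (TangentBundle 𝓘(ℝ, V) V) where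
  add_assoc X Y Z := toProd.injective (by simp only [toProd_add, add_assoc])
  zero_add X := toProd.injective (by simp only [toProd_add, toProd_zero, zero_add])
  add_zero X := toProd.injective (by simp only [toProd_add, toProd_zero, add_zero])
  neg_add_cancel X := toProd.injective (by
    simp only [toProd_add, toProd_zero, toProd_neg, neg_add_cancel])
  add_comm X Y := toProd.injective (by simp only [toProd_add, add_comm])
  nsmul := nsmulRec
  zsmul := zsmulRec

instance instModuleTangent : Module ℝ (TangentBundle 𝓘(ℝ, V) V) where
  one_smul X := toProd.injective (by simp only [toProd_smul, one_smul])
  mul_smul c d X := toProd.injective (by simp only [toProd_smul, mul_smul])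
  smul_zero c := toProd.injective (by simp only [toProd_smul, toProd_zero, smul_zero])
  smul_add c X Y := toProd.injective (by simp only [toProd_smul, toProd_add, smul_add])
  add_smul c d X := toProd.injective (by simp only [toProd_smul, toProd_add, add_smul])
  zero_smul X := toProd.injective (by simp only [toProd_smul, toProd_zero, zero_smul])

/-- `toProd` as a linear isomorphism. -/
def toProdₗ : TangentBundle 𝓘(ℝ, V) V ≃ₗ[ℝ] V × V :=
  { toProd with
    map_add' := toProd_add
    map_smul' := toProd_smul }

lemma isInducing_toProd :
    Topology.IsInducing (toProdₗ : TangentBundle 𝓘(ℝ, V) V → V × V) :=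
  (tangentBundleModelSpaceHomeomorph 𝓘(ℝ, V)).isInducing

/-- The norm of the vector `v ∈ T_p V` as an element of the vector space `TV` is
`max ‖p‖ ‖v‖`; its topology is (definitionally) that of the tangent bundle. As `TV` is
finite-dimensional when `V` is, the norm only serves to let Mathlib see `TV` and `Aut (TV)` as
manifolds. -/
instance instNormedAddCommGroupTangent : NormedAddCommGroup (TangentBundle 𝓘(ℝ, V) V) :=
  let N : NormedAddCommGroup (TangentBundle 𝓘(ℝ, V) V) :=
    NormedAddCommGroup.induced (TangentBundle 𝓘(ℝ, V) V) (V × V)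
      (toProdₗ : TangentBundle 𝓘(ℝ, V) V ≃ₗ[ℝ] V × V) toProdₗ.injective
  { instAddCommGroupTangent with
    norm := N.norm
    toMetricSpace := N.toMetricSpace.replaceTopology isInducing_toProd.eq_induced
    dist_eq := N.dist_eq }

instance instNormedSpaceTangent : NormedSpace ℝ (TangentBundle 𝓘(ℝ, V) V) where
  norm_smul_le c X := by
    change ‖toProdₗ (c • X)‖ ≤ ‖c‖ * ‖toProdₗ X‖
    rw [map_smul, norm_smul]

instance instFiniteDimensionalTangent [FiniteDimensional ℝ V] :
    FiniteDimensional ℝ (TangentBundle 𝓘(ℝ, V) V) :=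
  Module.Finite.equiv toProdₗ.symm


/-- The bundle trivialization `ψ : TV → V × ℝⁿ` given by the linear coordinates of a basis `α`:
`ψ (∑ vᵢ (∂/∂xᵢ)_p) = (p, v)`. -/
def trivializationEquiv {n : ℕ} (α : Module.Basis (Fin n) ℝ V) :
    TangentBundle 𝓘(ℝ, V) V ≃ₗ[ℝ] V × (Fin n → ℝ) :=
  toProdₗ.trans ((LinearEquiv.refl ℝ V).prodCongr α.equivFun)

/-- The basis `ψ⁻¹ (α₁, 0), …, ψ⁻¹ (αₙ, 0), ψ⁻¹ (0, e₁), …, ψ⁻¹ (0, eₙ)` of `TV`. -/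
def tangentBasis {n : ℕ} (α : Module.Basis (Fin n) ℝ V) :
    Module.Basis (Fin n ⊕ Fin n) ℝ (TangentBundle 𝓘(ℝ, V) V) :=
  (α.prod (Pi.basisFun ℝ (Fin n))).map (trivializationEquiv α).symm

end TangentVector
section Representations

/-- A finite-dimensional real representation `(G, V)` of a Lie group `G`: a (smooth) homomorphism
of Lie groups `G → Aut V`, where `Aut V` is the group of units of `End V`. -/
abbrev LieRep {E : Type*} [NormedAddCommGroup E] [NormedSpace ℝ E] {H : Type*} [TopologicalSpace H]
    (I : ModelWithCorners ℝ E H) (G : Type*) [TopologicalSpace G] [ChartedSpace H G] [Group G]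
    [LieGroup I ∞ G] (V : Type*) [NormedAddCommGroup V] [NormedSpace ℝ V]
    [FiniteDimensional ℝ V] :=
  ContMDiffMonoidMorphism I 𝓘(ℝ, V →L[ℝ] V) ∞ G (V →L[ℝ] V)ˣ

open scoped Matrix.Norms.L2Operator

lemma contMDiff_unitsMap {R S : Type*} [NormedRing R] [NormedAlgebra ℝ R] [CompleteSpace R]
    [NormedRing S] [NormedAlgebra ℝ S] [CompleteSpace S] [FiniteDimensional ℝ R]
    (f : R ≃ₐ[ℝ] S) :
    ContMDiff 𝓘(ℝ, R) 𝓘(ℝ, S) ∞ (Units.mapEquiv f.toMulEquiv : Rˣ → Sˣ) := by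
  apply ContMDiff.of_comp_isOpenEmbedding Units.isOpenEmbedding_val
  have h : ContDiff ℝ ∞ (f : R → S) :=
    (LinearMap.toContinuousLinearMap f.toLinearMap).contDiff
  exact h.contMDiff.comp (Units.contMDiff_val (𝕜 := ℝ) (R := R))

variable {V : Type*} [NormedAddCommGroup V] [NormedSpace ℝ V] [FiniteDimensional ℝ V]

/-- The isomorphism of algebras that maps an endomorphism of `V` to its matrix in a basis. -/
def endEquivMatrix {ι : Type*} [Fintype ι] [DecidableEq ι] (α : Module.Basis ι ℝ V) :
    (V →L[ℝ] V) ≃ₐ[ℝ] Matrix ι ι ℝ :=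
  (Module.End.toContinuousLinearMap (𝕜 := ℝ) V).symm.trans (LinearMap.toMatrixAlgEquiv α)

/-- The group isomorphism `Z : Aut V → GL(ι, ℝ)` that maps an automorphism to its matrix in a
basis. -/
def autEquivGL {ι : Type*} [Fintype ι] [DecidableEq ι] (α : Module.Basis ι ℝ V) :
    (V →L[ℝ] V)ˣ ≃* GL ι ℝ :=
  Units.mapEquiv (endEquivMatrix α).toMulEquiv

lemma contMDiff_autEquivGL {ι : Type*} [Fintype ι] [DecidableEq ι] (α : Module.Basis ι ℝ V) :
    ContMDiff 𝓘(ℝ, V →L[ℝ] V) 𝓘(ℝ, Matrix ι ι ℝ) ∞ (autEquivGL α) :=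
  contMDiff_unitsMap (endEquivMatrix α)

lemma contMDiff_autEquivGL_symm {ι : Type*} [Fintype ι] [DecidableEq ι]
    (α : Module.Basis ι ℝ V) :
    ContMDiff 𝓘(ℝ, Matrix ι ι ℝ) 𝓘(ℝ, V →L[ℝ] V) ∞ (autEquivGL α).symm :=
  contMDiff_unitsMap (endEquivMatrix α).symm

/-- `Z` as a homomorphism of Lie groups. -/
def autToGL {n : ℕ} (α : Module.Basis (Fin n) ℝ V) :
    ContMDiffMonoidMorphism 𝓘(ℝ, V →L[ℝ] V) 𝓘(ℝ, Matrix (Fin n) (Fin n) ℝ) ∞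
      (V →L[ℝ] V)ˣ (GL (Fin n) ℝ) where
  toMonoidHom := (autEquivGL α).toMonoidHom
  contMDiff_toFun := contMDiff_autEquivGL α

section J

variable {n : ℕ}

/-- The matrix of entries of a tangent vector of `GL(n, ℝ)`, an open subset of the space of
matrices. -/
def tangentMatrix (Y : TangentBundle 𝓘(ℝ, Matrix (Fin n) (Fin n) ℝ) (GL (Fin n) ℝ)) :
    Matrix (Fin n) (Fin n) ℝ :=
  (tangentMap 𝓘(ℝ, Matrix (Fin n) (Fin n) ℝ) 𝓘(ℝ, Matrix (Fin n) (Fin n) ℝ)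
    (Units.val : GL (Fin n) ℝ → Matrix (Fin n) (Fin n) ℝ) Y).snd

/-- For `Y ∈ T_a GL(n, ℝ)`, the matrix `B` of the vector `TR_{a⁻¹} Y` of the Lie algebra of
`GL(n, ℝ)`, where `R_{a⁻¹}` is the right translation; so `Y = [a, B]`. -/
def rightLog (Y : TangentBundle 𝓘(ℝ, Matrix (Fin n) (Fin n) ℝ) (GL (Fin n) ℝ)) :
    Matrix (Fin n) (Fin n) ℝ :=
  tangentMatrix (tangentMap 𝓘(ℝ, Matrix (Fin n) (Fin n) ℝ) 𝓘(ℝ, Matrix (Fin n) (Fin n) ℝ)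
    (fun y : GL (Fin n) ℝ => y * Y.proj⁻¹) Y)

/-- The map `J_n : T GL(n, ℝ) → GL(2n, ℝ)`, which sends `[a, B]` to the block matrix with rows
`(a, 0)` and `(B a, a)`. -/
def jMap (Y : TangentBundle 𝓘(ℝ, Matrix (Fin n) (Fin n) ℝ) (GL (Fin n) ℝ)) :
    GL (Fin n ⊕ Fin n) ℝ where
  val := Matrix.fromBlocks (Y.proj : Matrix (Fin n) (Fin n) ℝ) 0
    (rightLog Y * (Y.proj : Matrix (Fin n) (Fin n) ℝ)) (Y.proj : Matrix (Fin n) (Fin n) ℝ)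
  inv := Matrix.fromBlocks ((Y.proj⁻¹ : GL (Fin n) ℝ) : Matrix (Fin n) (Fin n) ℝ) 0
    (-(((Y.proj⁻¹ : GL (Fin n) ℝ) : Matrix (Fin n) (Fin n) ℝ) * rightLog Y))
    ((Y.proj⁻¹ : GL (Fin n) ℝ) : Matrix (Fin n) (Fin n) ℝ)
  val_inv := by
    rw [Matrix.fromBlocks_multiply, ← Matrix.fromBlocks_one]
    congr 1 <;> simp [← mul_assoc]
  inv_val := by
    rw [Matrix.fromBlocks_multiply, ← Matrix.fromBlocks_one]
    congr 1 <;> simp [mul_assoc]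

lemma mdiff_val : MDifferentiable 𝓘(ℝ, Matrix (Fin n) (Fin n) ℝ) 𝓘(ℝ, Matrix (Fin n) (Fin n) ℝ)
    (Units.val : GL (Fin n) ℝ → Matrix (Fin n) (Fin n) ℝ) :=
  (Units.contMDiff_val (𝕜 := ℝ) (n := ∞)).mdifferentiable (by simp)

lemma tangentMatrix_mul (X Y : TangentBundle 𝓘(ℝ, Matrix (Fin n) (Fin n) ℝ) (GL (Fin n) ℝ)) :
    tangentMatrix (X * Y) =
      tangentMatrix X * (Y.proj : Matrix (Fin n) (Fin n) ℝ)
        + (X.proj : Matrix (Fin n) (Fin n) ℝ) * tangentMatrix Y := by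
  let J := 𝓘(ℝ, Matrix (Fin n) (Fin n) ℝ)
  have hX := ((mdiff_val (n := n)) X.proj).hasMFDerivAt
  have hY := ((mdiff_val (n := n)) Y.proj).hasMFDerivAt
  have h1 := HasMFDerivAt.comp (I := J.prod J) (I' := J) (I'' := J) (X.proj, Y.proj) hX
    (hasMFDerivAt_fst (I := J) (I' := J) (X.proj, Y.proj))
  have h2 := HasMFDerivAt.comp (I := J.prod J) (I' := J) (I'' := J) (X.proj, Y.proj) hY
    (hasMFDerivAt_snd (I := J) (I' := J) (X.proj, Y.proj))
  have h := (HasMFDerivAt.mul' h1 h2).mfderiv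
  have hm : MDifferentiable (J.prod J) J (fun p : GL (Fin n) ℝ × GL (Fin n) ℝ => p.1 * p.2) :=
    (contMDiff_mul J ∞).mdifferentiable (by simp)
  have hc := mfderiv_comp (I := J.prod J) (I' := J) (I'' := J) (X.proj, Y.proj)
    ((mdiff_val (n := n)) (X.proj * Y.proj)) (hm (X.proj, Y.proj))
  have h3 := hc.symm.trans h
  have h4 := DFunLike.congr_fun h3 (X.snd, Y.snd)
  refine h4.trans ?_
  rw [add_comm]
  rfl

lemma rightLog_mul (Y : TangentBundle 𝓘(ℝ, Matrix (Fin n) (Fin n) ℝ) (GL (Fin n) ℝ)) :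
    rightLog Y * (Y.proj : Matrix (Fin n) (Fin n) ℝ) = tangentMatrix Y := by
  have h := tangentMap_mul (I := 𝓘(ℝ, Matrix (Fin n) (Fin n) ℝ))
    (J := 𝓘(ℝ, Matrix (Fin n) (Fin n) ℝ)) (u := (id : GL (Fin n) ℝ → GL (Fin n) ℝ))
    (v := fun _ => Y.proj⁻¹) mdifferentiable_id mdifferentiable_const Y
  have h0 : tangentMatrix (tangentMap 𝓘(ℝ, Matrix (Fin n) (Fin n) ℝ)
      𝓘(ℝ, Matrix (Fin n) (Fin n) ℝ) (fun _ : GL (Fin n) ℝ => Y.proj⁻¹) Y) = 0 := by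
    simp only [tangentMatrix, tangentMap, mfderiv_const]
    exact map_zero _
  have h1 : rightLog Y = tangentMatrix Y * ((Y.proj⁻¹ : GL (Fin n) ℝ) : Matrix _ _ ℝ) := by
    refine (congrArg tangentMatrix h).trans ?_
    rw [tangentMatrix_mul, h0, mul_zero, add_zero, tangentMap_id]
    rfl
  rw [h1, mul_assoc, Units.inv_mul, mul_one]

lemma contMDiff_tangentMatrix :
    ContMDiff 𝓘(ℝ, Matrix (Fin n) (Fin n) ℝ).tangent 𝓘(ℝ, Matrix (Fin n) (Fin n) ℝ) ∞
      (tangentMatrix (n := n)) :=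
  (contMDiff_snd_tangentBundle_modelSpace (Matrix (Fin n) (Fin n) ℝ)
    𝓘(ℝ, Matrix (Fin n) (Fin n) ℝ)).comp
    ((Units.contMDiff_val (𝕜 := ℝ) (n := ∞)).contMDiff_tangentMap (by simp))

/-- `(a, c) ↦ fromBlocks a 0 c a` as a linear map. -/
def blockMap : Matrix (Fin n) (Fin n) ℝ × Matrix (Fin n) (Fin n) ℝ →ₗ[ℝ]
    Matrix (Fin n ⊕ Fin n) (Fin n ⊕ Fin n) ℝ where
  toFun p := Matrix.fromBlocks p.1 0 p.2 p.1
  map_add' p q := by simp [Matrix.fromBlocks_add]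
  map_smul' c p := by simp [Matrix.fromBlocks_smul]

/-- `J_n` as a homomorphism of Lie groups. -/
def jHom : ContMDiffMonoidMorphism 𝓘(ℝ, Matrix (Fin n) (Fin n) ℝ).tangent
    𝓘(ℝ, Matrix (Fin n ⊕ Fin n) (Fin n ⊕ Fin n) ℝ) ∞
    (TangentBundle 𝓘(ℝ, Matrix (Fin n) (Fin n) ℝ) (GL (Fin n) ℝ)) (GL (Fin n ⊕ Fin n) ℝ) where
  toMonoidHom := MonoidHom.mk' jMap fun X Y => by
    apply Units.ext
    change Matrix.fromBlocks (X.proj.val * Y.proj.val) 0 (rightLog (X * Y) * (X * Y).proj.val)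
        (X.proj.val * Y.proj.val)
      = Matrix.fromBlocks X.proj.val 0 (rightLog X * X.proj.val) X.proj.val
        * Matrix.fromBlocks Y.proj.val 0 (rightLog Y * Y.proj.val) Y.proj.val
    rw [rightLog_mul, rightLog_mul, rightLog_mul, tangentMatrix_mul, Matrix.fromBlocks_multiply]
    simp only [mul_zero, zero_mul, add_zero, zero_add]
  contMDiff_toFun := by
    apply ContMDiff.of_comp_isOpenEmbedding Units.isOpenEmbedding_val
    have hp : ContMDiff 𝓘(ℝ, Matrix (Fin n) (Fin n) ℝ).tangent 𝓘(ℝ, Matrix (Fin n) (Fin n) ℝ) ∞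
        (fun Y : TangentBundle 𝓘(ℝ, Matrix (Fin n) (Fin n) ℝ) (GL (Fin n) ℝ) =>
          (Y.proj : Matrix (Fin n) (Fin n) ℝ)) :=
      (Units.contMDiff_val (𝕜 := ℝ) (n := ∞)).comp (contMDiff_proj _)
    have h := ((LinearMap.toContinuousLinearMap (blockMap (n := n))).contDiff
      (n := ∞)).contMDiff.comp (hp.prodMk_space contMDiff_tangentMatrix)
    refine h.congr fun Y => ?_
    change Matrix.fromBlocks _ _ (rightLog Y * _) _ = _
    rw [rightLog_mul]
    rfl

end J

variable {E : Type*} [NormedAddCommGroup E] [NormedSpace ℝ E] {H : Type*} [TopologicalSpace H]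
  {I : ModelWithCorners ℝ E H} {G : Type*} [TopologicalSpace G] [ChartedSpace H G] [Group G]
  [LieGroup I ∞ G]

/-- The prolongation `Z̆⁻¹ ∘ J_n ∘ TZ ∘ TΦ : TG → Aut (TV)` of a representation `Φ : G → Aut V`.
Here `α` is a basis of `V`, `Z : Aut V → GL(n, ℝ)` is the isomorphism it defines, and
`Z̆ : Aut (TV) → GL(2n, ℝ)` is the isomorphism defined by the basis `tangentBasis α` of `TV`. -/
def LieRep.prolongation {n : ℕ} (α : Module.Basis (Fin n) ℝ V) (Φ : LieRep I G V) :
    LieRep I.tangent (TangentBundle I G) (TangentBundle 𝓘(ℝ, V) V) where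
  toMonoidHom := (autEquivGL (tangentBasis α)).symm.toMonoidHom.comp
    ((jHom (n := n)).toMonoidHom.comp
      ((tangentHom (autToGL α)).toMonoidHom.comp (tangentHom Φ).toMonoidHom))
  contMDiff_toFun := (contMDiff_autEquivGL_symm (tangentBasis α)).comp
    ((jHom (n := n)).contMDiff_toFun.comp
      ((tangentHom (autToGL α)).contMDiff_toFun.comp (tangentHom Φ).contMDiff_toFun))

variable {V' : Type*} [NormedAddCommGroup V'] [NormedSpace ℝ V'] [FiniteDimensional ℝ V']

/-- `A : V → V'` is an equivalence from `Φ` to `Φ'`: a linear isomorphism with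
`A (Φ(g) p) = Φ'(g) (A p)`. -/
def LieRep.IsIntertwining (Φ : LieRep I G V) (Φ' : LieRep I G V') (A : V ≃ₗ[ℝ] V') : Prop :=
  ∀ (g : G) (p : V), A ((Φ g : V →L[ℝ] V) p) = (Φ' g : V' →L[ℝ] V') (A p)

/-- Equivalent representations. -/
def LieRep.Equivalent (Φ : LieRep I G V) (Φ' : LieRep I G V') : Prop :=
  ∃ A : V ≃ₗ[ℝ] V', LieRep.IsIntertwining Φ Φ' A

end Representations
end Prolongation
end

/-
The prolongation is the tangent action: `Φ̃(X)(Y)` is the value at `(X, Y)` of the tangent map of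
`G × V → V`, `(g, p) ↦ Φ(g) p`. Indeed, for `X ∈ T_g G` and `Y = (p, v)`, the latter is
`(Φ(g) p, (dΦ X) p + Φ(g) v)` by the product rule, and the matrix of this map of `(p, v)` is the
block matrix `J_n` with rows `(a, 0)` and `(B a, a)`, since `B a` is the matrix of `dΦ X`. Hence the
basis plays no role, and applying the tangent functor to `A (Φ(g) p) = Φ'(g) (A p)`, as an
identity of maps of `(g, p)`, gives the claim.
-/

noncomputable section

namespace Prolongation

section TangentMap

variable {E : Type*} [NormedAddCommGroup E] [NormedSpace ℝ E] {H : Type*} [TopologicalSpace H]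
  {I : ModelWithCorners ℝ E H} {M : Type*} [TopologicalSpace M] [ChartedSpace H M]
  {V : Type*} [NormedAddCommGroup V] [NormedSpace ℝ V]
  {V' : Type*} [NormedAddCommGroup V'] [NormedSpace ℝ V']

lemma leftInverse_tangentMap
    {E₁ : Type*} [NormedAddCommGroup E₁] [NormedSpace ℝ E₁] {H₁ : Type*} [TopologicalSpace H₁]
    {I₁ : ModelWithCorners ℝ E₁ H₁} {M₁ : Type*} [TopologicalSpace M₁] [ChartedSpace H₁ M₁]
    {f : M → M₁} {g : M₁ → M} (h : Function.LeftInverse g f) (hg : MDifferentiable I₁ I g)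
    (hf : MDifferentiable I I₁ f) :
    Function.LeftInverse (tangentMap I₁ I g) (tangentMap I I₁ f) :=
  Function.leftInverse_iff_comp.mpr <| by rw [← tangentMap_comp hg hf, h.comp_eq_id, tangentMap_id]

lemma tangentMap_prodMap_equivTangentBundleProd_symm
    {E₁ : Type*} [NormedAddCommGroup E₁] [NormedSpace ℝ E₁] {H₁ : Type*} [TopologicalSpace H₁]
    {I₁ : ModelWithCorners ℝ E₁ H₁} {M₁ : Type*} [TopologicalSpace M₁] [ChartedSpace H₁ M₁]
    {E₂ : Type*} [NormedAddCommGroup E₂] [NormedSpace ℝ E₂] {H₂ : Type*} [TopologicalSpace H₂]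
    {J₁ : ModelWithCorners ℝ E₂ H₂} {N₁ : Type*} [TopologicalSpace N₁] [ChartedSpace H₂ N₁]
    {E₃ : Type*} [NormedAddCommGroup E₃] [NormedSpace ℝ E₃] {H₃ : Type*} [TopologicalSpace H₃]
    {J₂ : ModelWithCorners ℝ E₃ H₃} {N₂ : Type*} [TopologicalSpace N₂] [ChartedSpace H₃ N₂]
    {f : M → N₁} {g : M₁ → N₂} (X : TangentBundle I M) (Y : TangentBundle I₁ M₁)
    (hf : MDifferentiableAt I J₁ f X.proj) (hg : MDifferentiableAt I₁ J₂ g Y.proj) :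
    tangentMap (I.prod I₁) (J₁.prod J₂) (Prod.map f g)
        ((equivTangentBundleProd I M I₁ M₁).symm (X, Y)) =
      (equivTangentBundleProd J₁ N₁ J₂ N₂).symm (tangentMap I J₁ f X, tangentMap I₁ J₂ g Y) := by
  simp only [tangentMap, equivTangentBundleProd_symm_apply_snd]
  rw [mfderiv_prodMap hf hg]
  rfl

lemma toProd_tangentMap (A : V →L[ℝ] V') (Y : TangentBundle 𝓘(ℝ, V) V) :
    toProd (tangentMap 𝓘(ℝ, V) 𝓘(ℝ, V') A Y) = A.prodMap A (toProd Y) := by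
  simp only [tangentMap, A.mfderiv_eq]
  rfl

lemma isLinearMap_tangentMap (A : V →L[ℝ] V') :
    IsLinearMap ℝ (tangentMap 𝓘(ℝ, V) 𝓘(ℝ, V') A) where
  map_add X Y := toProd.injective <| by simp only [toProd_add, toProd_tangentMap, map_add]
  map_smul c X := toProd.injective <| by simp only [toProd_smul, toProd_tangentMap, map_smul]

/-- The tangent map `TA : TV → TV'` of an isomorphism `A : V → V'`, as a linear isomorphism. -/
def tangentEquiv (A : V ≃L[ℝ] V') :
    TangentBundle 𝓘(ℝ, V) V ≃ₗ[ℝ] TangentBundle 𝓘(ℝ, V') V' where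
  toFun := tangentMap 𝓘(ℝ, V) 𝓘(ℝ, V') A
  invFun := tangentMap 𝓘(ℝ, V') 𝓘(ℝ, V) A.symm
  map_add' := (isLinearMap_tangentMap (A : V →L[ℝ] V')).map_add
  map_smul' := (isLinearMap_tangentMap (A : V →L[ℝ] V')).map_smul
  left_inv := leftInverse_tangentMap A.symm_apply_apply
    A.symm.mdifferentiable A.mdifferentiable
  right_inv := leftInverse_tangentMap A.apply_symm_apply
    A.mdifferentiable A.symm.mdifferentiable

lemma toProd_tangentMap_clm_apply {T : M → V →L[ℝ] V'} (X : TangentBundle I M)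
    (hT : MDifferentiableAt I 𝓘(ℝ, V →L[ℝ] V') T X.proj) (Y : TangentBundle 𝓘(ℝ, V) V) :
    toProd (tangentMap (I.prod 𝓘(ℝ, V)) 𝓘(ℝ, V') (fun q : M × V => T q.1 q.2)
        ((equivTangentBundleProd I M 𝓘(ℝ, V) V).symm (X, Y))) =
      (T X.proj (toProd Y).1,
        (toProd (tangentMap I 𝓘(ℝ, V →L[ℝ] V') T X)).2 (toProd Y).1
          + T X.proj (toProd Y).2) := by
  have hleft : mfderiv I 𝓘(ℝ, V') (fun x => T x Y.proj) X.proj X.snd =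
      (toProd (tangentMap I 𝓘(ℝ, V →L[ℝ] V') T X)).2 Y.proj := by
    let ev := ContinuousLinearMap.apply ℝ V' Y.proj
    refine (mfderiv_comp_apply (g := ev) X.proj ev.mdifferentiableAt hT X.snd).trans ?_
    rw [ev.mfderiv_eq]
    rfl
  have hright : mfderiv 𝓘(ℝ, V) 𝓘(ℝ, V') (T X.proj) Y.proj = T X.proj :=
    (T X.proj).mfderiv_eq
  have heval : MDifferentiableAt (I.prod 𝓘(ℝ, V)) 𝓘(ℝ, V') (fun q : M × V => T q.1 q.2)
      (X.proj, Y.proj) :=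
    (hT.comp (X.proj, Y.proj) mdifferentiableAt_fst).clm_apply mdifferentiableAt_snd
  refine Prod.ext rfl ((mfderiv_prod_eq_add_apply heval).trans ?_)
  exact congrArg₂ (· + ·) hleft (DFunLike.congr_fun hright Y.snd)

end TangentMap

section Coordinates

variable {V : Type*} [NormedAddCommGroup V] [NormedSpace ℝ V]

lemma tangentBasis_repr {n : ℕ} (α : Module.Basis (Fin n) ℝ V) (Y : TangentBundle 𝓘(ℝ, V) V) :
    ⇑((tangentBasis α).repr Y) = Sum.elim (α.repr (toProd Y).1) (α.repr (toProd Y).2) := by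
  ext (i | i)
  · simp [tangentBasis, trivializationEquiv, toProdₗ]
  · simp [tangentBasis, trivializationEquiv, toProdₗ]

variable [FiniteDimensional ℝ V]

lemma endEquivMatrix_mulVec_repr {ι : Type*} [Fintype ι] [DecidableEq ι]
    (α : Module.Basis ι ℝ V) (f : V →L[ℝ] V) (v : V) :
    (endEquivMatrix α f).mulVec (α.repr v) = α.repr (f v) :=
  LinearMap.toMatrix_mulVec_repr α α (f : V →ₗ[ℝ] V) v

lemma toProd_apply_of_endEquivMatrix_eq_fromBlocks {n : ℕ} (α : Module.Basis (Fin n) ℝ V)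
    {F : TangentBundle 𝓘(ℝ, V) V →L[ℝ] TangentBundle 𝓘(ℝ, V) V} {a b c d : V →L[ℝ] V}
    (hF : endEquivMatrix (tangentBasis α) F =
      Matrix.fromBlocks (endEquivMatrix α a) (endEquivMatrix α b)
        (endEquivMatrix α c) (endEquivMatrix α d))
    (Y : TangentBundle 𝓘(ℝ, V) V) :
    toProd (F Y) =
      (a (toProd Y).1 + b (toProd Y).2, c (toProd Y).1 + d (toProd Y).2) := by
  have hcoord := endEquivMatrix_mulVec_repr (tangentBasis α) F Y
  simp only [hF, tangentBasis_repr, Matrix.fromBlocks_mulVec, Sum.elim_comp_inl,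
    Sum.elim_comp_inr, endEquivMatrix_mulVec_repr, ← Finsupp.coe_add, ← map_add] at hcoord
  obtain ⟨hbase, hvec⟩ := Sum.elim_eq_iff.mp hcoord
  exact Prod.ext (α.repr.injective (DFunLike.coe_injective hbase.symm))
    (α.repr.injective (DFunLike.coe_injective hvec.symm))

end Coordinates

section Representations

open scoped Matrix.Norms.L2Operator

variable {E : Type*} [NormedAddCommGroup E] [NormedSpace ℝ E] {H : Type*} [TopologicalSpace H]
  {I : ModelWithCorners ℝ E H} {G : Type*} [TopologicalSpace G] [ChartedSpace H G] [Group G]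
  [LieGroup I ∞ G]
  {V : Type*} [NormedAddCommGroup V] [NormedSpace ℝ V] [FiniteDimensional ℝ V]
  {n : ℕ} (α : Module.Basis (Fin n) ℝ V) (Φ : LieRep I G V)

namespace LieRep

/-- The representation `Φ` as a map into the vector space `End V`, which contains `Aut V` as an
open subset. -/
def toEnd (g : G) : V →L[ℝ] V := Φ g

/-- The differential of `Φ` as an endomorphism of `V`: the vector part of the tangent map of
`toEnd Φ : G → End V`. -/
def differential (X : TangentBundle I G) : V →L[ℝ] V :=
  (toProd (tangentMap I 𝓘(ℝ, V →L[ℝ] V) Φ.toEnd X)).2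

/-- The action `(g, p) ↦ Φ(g) p` of `G` on `V`. -/
def action (q : G × V) : V := Φ.toEnd q.1 q.2

lemma mdifferentiable_toEnd : MDifferentiable I 𝓘(ℝ, V →L[ℝ] V) Φ.toEnd :=
  ((Units.contMDiff_val (𝕜 := ℝ) (n := ∞)).comp Φ.contMDiff_toFun).mdifferentiable (by simp)

lemma mdifferentiable_action : MDifferentiable (I.prod 𝓘(ℝ, V)) 𝓘(ℝ, V) Φ.action :=
  (Φ.mdifferentiable_toEnd.comp mdifferentiable_fst).clm_apply mdifferentiable_snd

end LieRep

lemma tangentMatrix_tangentHom_autToGL (X : TangentBundle I G) :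
    tangentMatrix (tangentHom (autToGL α) (tangentHom Φ X)) =
      endEquivMatrix α (Φ.differential X) := by
  let L : (V →L[ℝ] V) →L[ℝ] Matrix (Fin n) (Fin n) ℝ :=
    LinearMap.toContinuousLinearMap (endEquivMatrix α).toLinearMap
  have hZ : MDifferentiable 𝓘(ℝ, V →L[ℝ] V) 𝓘(ℝ, Matrix (Fin n) (Fin n) ℝ) (autToGL α) :=
    (autToGL α).contMDiff_toFun.mdifferentiable (by simp)
  have hΦ : MDifferentiable I 𝓘(ℝ, V →L[ℝ] V) Φ := Φ.contMDiff_toFun.mdifferentiable (by simp)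
  have htangent : tangentMap 𝓘(ℝ, Matrix (Fin n) (Fin n) ℝ) 𝓘(ℝ, Matrix (Fin n) (Fin n) ℝ)
        (Units.val : GL (Fin n) ℝ → Matrix (Fin n) (Fin n) ℝ)
        (tangentHom (autToGL α) (tangentHom Φ X)) =
      tangentMap 𝓘(ℝ, V →L[ℝ] V) 𝓘(ℝ, Matrix (Fin n) (Fin n) ℝ) L
        (tangentMap I 𝓘(ℝ, V →L[ℝ] V) Φ.toEnd X) :=
    calc
      _ = tangentMap I 𝓘(ℝ, Matrix (Fin n) (Fin n) ℝ) (Units.val ∘ autToGL α ∘ Φ) X := by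
        rw [tangentMap_comp mdiff_val (hZ.comp hΦ), tangentMap_comp hZ hΦ]
        rfl
      _ = tangentMap I 𝓘(ℝ, Matrix (Fin n) (Fin n) ℝ) (L ∘ Φ.toEnd) X := rfl
      _ = _ := by
        rw [tangentMap_comp L.mdifferentiable Φ.mdifferentiable_toEnd]
        rfl
  exact congrArg Prod.snd ((congrArg toProd htangent).trans (toProd_tangentMap L _))

lemma endEquivMatrix_prolongation (X : TangentBundle I G) :
    endEquivMatrix (tangentBasis α) ((Φ.prolongation α).toEnd X) =
      Matrix.fromBlocks (endEquivMatrix α (Φ.toEnd X.proj)) 0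
        (endEquivMatrix α (Φ.differential X)) (endEquivMatrix α (Φ.toEnd X.proj)) := by
  have hGL : autEquivGL (tangentBasis α) (Φ.prolongation α X) =
      jMap (tangentHom (autToGL α) (tangentHom Φ X)) :=
    (autEquivGL (tangentBasis α)).apply_symm_apply _
  refine (congrArg Units.val hGL).trans ?_
  rw [← tangentMatrix_tangentHom_autToGL, ← rightLog_mul]
  rfl

theorem prolongation_apply_eq_tangentMap_action (X : TangentBundle I G)
    (Y : TangentBundle 𝓘(ℝ, V) V) :
    (Φ.prolongation α).toEnd X Y =
      tangentMap (I.prod 𝓘(ℝ, V)) 𝓘(ℝ, V) Φ.action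
        ((equivTangentBundleProd I G 𝓘(ℝ, V) V).symm (X, Y)) := by
  have hblocks := endEquivMatrix_prolongation α Φ X
  rw [← map_zero (endEquivMatrix α)] at hblocks
  apply toProd.injective
  calc toProd ((Φ.prolongation α).toEnd X Y)
    _ = (Φ.toEnd X.proj (toProd Y).1,
          Φ.differential X (toProd Y).1 + Φ.toEnd X.proj (toProd Y).2) := by
      rw [toProd_apply_of_endEquivMatrix_eq_fromBlocks α hblocks, zero_apply, add_zero]
    _ = _ := (toProd_tangentMap_clm_apply X (Φ.mdifferentiable_toEnd _) Y).symm

end Representations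

end Prolongation

end

open Prolongation in
theorem proposition3p8_general
    {E : Type*} [NormedAddCommGroup E] [NormedSpace ℝ E]
    {H : Type*} [TopologicalSpace H] {I : ModelWithCorners ℝ E H}
    {G : Type*} [TopologicalSpace G] [ChartedSpace H G] [Group G] [LieGroup I ∞ G]
    {V : Type*} [NormedAddCommGroup V] [NormedSpace ℝ V] [FiniteDimensional ℝ V]
    {V' : Type*} [NormedAddCommGroup V'] [NormedSpace ℝ V'] [FiniteDimensional ℝ V']
    {n n' : ℕ} (α : Module.Basis (Fin n) ℝ V) (α' : Module.Basis (Fin n') ℝ V')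
    {Φ : LieRep I G V} {Φ' : LieRep I G V'} (A : V →L[ℝ] V')
    (hA : ∀ (g : G) (p : V), A ((Φ g : V →L[ℝ] V) p) = (Φ' g : V' →L[ℝ] V') (A p))
    (X : TangentBundle I G) (Y : TangentBundle 𝓘(ℝ, V) V) :
    tangentMap 𝓘(ℝ, V) 𝓘(ℝ, V') A
        ((Φ.prolongation α X : TangentBundle 𝓘(ℝ, V) V →L[ℝ] TangentBundle 𝓘(ℝ, V) V) Y) =
      (Φ'.prolongation α' X : TangentBundle 𝓘(ℝ, V') V' →L[ℝ] TangentBundle 𝓘(ℝ, V') V')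
        (tangentMap 𝓘(ℝ, V) 𝓘(ℝ, V') A Y) := by
  have haction : A ∘ Φ.action = Φ'.action ∘ Prod.map id A := funext fun q => hA q.1 q.2
  let XY := (equivTangentBundleProd I G 𝓘(ℝ, V) V).symm (X, Y)
  have hprod : tangentMap (I.prod 𝓘(ℝ, V)) (I.prod 𝓘(ℝ, V')) (Prod.map id A) XY =
      (equivTangentBundleProd I G 𝓘(ℝ, V') V').symm (X, tangentMap 𝓘(ℝ, V) 𝓘(ℝ, V') A Y) := by
    rw [tangentMap_prodMap_equivTangentBundleProd_symm X Y mdifferentiableAt_id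
      A.mdifferentiableAt, tangentMap_id, id]
  calc tangentMap 𝓘(ℝ, V) 𝓘(ℝ, V') A ((Φ.prolongation α).toEnd X Y)
    _ = tangentMap 𝓘(ℝ, V) 𝓘(ℝ, V') A (tangentMap (I.prod 𝓘(ℝ, V)) 𝓘(ℝ, V) Φ.action XY) := by
      rw [prolongation_apply_eq_tangentMap_action]
    _ = tangentMap (I.prod 𝓘(ℝ, V)) 𝓘(ℝ, V') (A ∘ Φ.action) XY := by
      rw [tangentMap_comp A.mdifferentiable Φ.mdifferentiable_action, Function.comp_apply]
    _ = tangentMap (I.prod 𝓘(ℝ, V')) 𝓘(ℝ, V') Φ'.action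
          (tangentMap (I.prod 𝓘(ℝ, V)) (I.prod 𝓘(ℝ, V')) (Prod.map id A) XY) := by
      rw [haction, tangentMap_comp Φ'.mdifferentiable_action
        (mdifferentiable_id.prodMap A.mdifferentiable), Function.comp_apply]
    _ = (Φ'.prolongation α').toEnd X (tangentMap 𝓘(ℝ, V) 𝓘(ℝ, V') A Y) := by
      rw [hprod, prolongation_apply_eq_tangentMap_action]

theorem proposition3p8
    {E : Type*} [NormedAddCommGroup E] [NormedSpace ℝ E]
    {H : Type*} [TopologicalSpace H] {I : ModelWithCorners ℝ E H}
    {G : Type*} [TopologicalSpace G] [ChartedSpace H G] [Group G] [LieGroup I ∞ G]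
    {V : Type*} [NormedAddCommGroup V] [NormedSpace ℝ V] [FiniteDimensional ℝ V]
    {V' : Type*} [NormedAddCommGroup V'] [NormedSpace ℝ V'] [FiniteDimensional ℝ V']
    {n n' : ℕ} (α : Module.Basis (Fin n) ℝ V) (α' : Module.Basis (Fin n') ℝ V')
    (Φ : Prolongation.LieRep I G V) (Φ' : Prolongation.LieRep I G V') :
    (Prolongation.LieRep.Equivalent Φ Φ' →
      Prolongation.LieRep.Equivalent (Prolongation.LieRep.prolongation α Φ)
        (Prolongation.LieRep.prolongation α' Φ')) ∧
    ∀ A : V ≃ₗ[ℝ] V', Prolongation.LieRep.IsIntertwining Φ Φ' A →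
      ∃ TA : TangentBundle 𝓘(ℝ, V) V ≃ₗ[ℝ] TangentBundle 𝓘(ℝ, V') V',
        (∀ Y, TA Y = tangentMap 𝓘(ℝ, V) 𝓘(ℝ, V') A Y) ∧
        Prolongation.LieRep.IsIntertwining (Prolongation.LieRep.prolongation α Φ)
          (Prolongation.LieRep.prolongation α' Φ') TA := by
  have hTA (A : V ≃ₗ[ℝ] V') (hA : Prolongation.LieRep.IsIntertwining Φ Φ' A) :=
    proposition3p8_general α α' (A.toContinuousLinearEquiv : V →L[ℝ] V') hA
  exact ⟨fun ⟨A, hA⟩ => ⟨Prolongation.tangentEquiv A.toContinuousLinearEquiv, hTA A hA⟩,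
    fun A hA => ⟨Prolongation.tangentEquiv A.toContinuousLinearEquiv, fun _ => rfl, hTA A hA⟩⟩
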